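/- Let $0<m<M$, put $\kappa=M/m$ and $E=[m,M]$, and let $\mathcal M(E)$ be the set of Borel probability measures on $\mathbb R$ supported on $E$. For $\mu,\nu\in\mathcal M(E)$ let $$\mathcal R(\mu,\nu)=\mathbb E_{\beta\sim\mu,\ \lambda\sim\nu}\,\log\left|1-\beta^{-1}\lambda\right|\in[-\infty,\infty),$$ where $\beta$ and $\lambda$ are independent and $\log 0=-\infty$. For $a<b$ let $\mathrm{Arcsine}(a,b)$ be the probability distribution with density $\frac{\mathbf 1_{x\in(a,b)}}{\pi\sqrt{(b-x)(x-a)}}$, and let $\mathrm{FlippedArcsine}(m,M)$ be the law of $\lambda$ when $\lambda^{-1}\sim\mathrm{Arcsine}(M^{-1},m^{-1})$. Consider the zero-sum game in which one player chooses $\mu\in\mathcal M(E)$ so as to minimize $\mathcal R(\mu,\nu)$ and the other chooses $\nu\in\mathcal M(E)$ so as to maximize it. Put $\mu^*=\mathrm{Arcsine}(m,M)$ and $\nu^*=\mathrm{FlippedArcsine}(m,M)$. Then $\mu^*,\nu^*\in\mathcal M(E)$ and the saddle point condition $$\sup_{\nu\in\mathcal M(E)}\mathcal R(\mu^*,\nu)=\mathcal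 R(\mu^*,\nu^*)=\inf_{\mu\in\mathcal M(E)}\mathcal R(\mu,\nu^*)$$ holds with $$\mathcal R(\mu^*,\nu^*)=\log\frac{\sqrt\kappa-1}{\sqrt\kappa+1}.$$ In particular the game has the minimax value $$\inf_{\mu\in\mathcal M(E)}\ \sup_{\nu\in\mathcal M(E)}\mathcal R(\mu,\nu)=\sup_{\nu\in\mathcal M(E)}\ \inf_{\mu\in\mathcal M(E)}\mathcal R(\mu,\nu)=\log\frac{\sqrt\kappa-1}{\sqrt\kappa+1}.$$ Moreover the optimal mixed strategies are unique: $\mu^*$ is the only minimizer of $\mu\mapsto\sup_{\nu}\mathcal R(\mu,\nu)$ over $\mathcal M(E)$, $\nu^*$ is the only maximizer of $\nu\mapsto\inf_{\mu}\mathcal R(\mu,\nu)$ over $\mathcal M(E)$, and $(\mu^*,\nu^*)$ is the only saddle point of the game. -/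

import Mathlib

/-- The Arcsine distribution on the interval `(a, b)`: the measure with Lebesgue density
`1 / (π √((b - x) (x - a)))` on `(a, b)` and `0` elsewhere. -/
noncomputable def arcsineMeasure (a b : ℝ) : MeasureTheory.Measure ℝ :=
  MeasureTheory.volume.withDensity fun x =>
    ENNReal.ofReal
      ((Set.Ioo a b).indicator (fun y => 1 / (Real.pi * Real.sqrt ((b - y) * (y - a)))) x)

/-- The Flipped Arcsine distribution: the law of `l` when `l⁻¹` has the Arcsine distribution on
`(M⁻¹, m⁻¹)`, that is, the image of that distribution under inversion. -/
noncomputable def flippedArcsineMeasure (m M : ℝ) : MeasureTheory.Measure ℝ :=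
  (arcsineMeasure M⁻¹ m⁻¹).map fun x => x⁻¹

/-- The mixed strategies: Borel probability measures on `ℝ` that are supported on `[m, M]`. -/
def mixedStrategies (m M : ℝ) : Set (MeasureTheory.Measure ℝ) :=
  {μ | MeasureTheory.IsProbabilityMeasure μ ∧ μ (Set.Icc m M)ᶜ = 0}

/-- `log |x|` with the convention `log 0 = -∞`. -/
noncomputable def extLogAbs (x : ℝ) : EReal :=
  ENNReal.log (ENNReal.ofReal |x|)

/-- The expectation of an extended-real function: the integral of the positive part minus the
integral of the negative part. The value is meaningful (possibly `±∞`) as soon as one of the two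
is finite; for the payoff below the positive part is bounded. -/
noncomputable def extExpectation {α : Type*} [MeasurableSpace α] (P : MeasureTheory.Measure α)
    (f : α → EReal) : EReal :=
  ((MeasureTheory.lintegral P fun x => (f x).toENNReal : ENNReal) : EReal) -
    ((MeasureTheory.lintegral P fun x => (-f x).toENNReal : ENNReal) : EReal)

/-- The payoff `E log |1 - β⁻¹ l|`, where `β ∼ μ` and `l ∼ ν` are independent. -/
noncomputable def payoff (μ ν : MeasureTheory.Measure ℝ) : EReal :=
  extExpectation (μ.prod ν) fun p => extLogAbs (1 - p.1⁻¹ * p.2)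

/-- The accelerated rate `(√κ - 1) / (√κ + 1)` with condition number `κ = M / m`. -/
noncomputable def accRate (m M : ℝ) : ℝ :=
  (Real.sqrt (M / m) - 1) / (Real.sqrt (M / m) + 1)

section

open MeasureTheory Polynomial intervalIntegral

/-! Since `log |1 - β⁻¹ l| = log |β - l| - log β`, the payoff is the logarithmic energy of `μ` and
`ν` minus a term depending on `μ` alone. The arcsine law is the equilibrium measure of `[m, M]`: its
potential is constant there, equal to `log ((M - m) / 4)`, and `∫ log` under it is `2 log ((√M + √m)
/ 2)`. The difference is the logarithm of `accRate m M`, so `μ*` equalizes all replies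
(`payoff_arcsineMeasure`). The substitution `(β, l) ↦ (l⁻¹, β⁻¹)` preserves `β⁻¹ l` and exchanges
the players (`payoff_map_inv`), so the flipped arcsine law equalizes as well
(`payoff_flippedArcsineMeasure`). Two equalizing strategies with the same value form a saddle point.

For uniqueness, let the payoffs of `μ` against all pure strategies lie on one side of the value.
Their average under `ν*` is the value, so they equal it `ν*`-almost everywhere, hence almost
everywhere for the arcsine law, and the potential of `μ` is almost everywhere constant. The
Chebyshev polynomials of degree `n ≥ 1` are eigenfunctions of the logarithmic kernel with the
nonzero eigenvalue `-1 / n`; integrating the constant potential against them shows that the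
Chebyshev moments of `μ` are those of the arcsine law, and Weierstrass approximation gives equality
(`eq_arcsineMeasure_of_potential_ae_const`). Inversion transfers this to `ν`. -/

/-! ### Logarithmic integrals over the half circle. -/

/-- The function `u ↦ log |2 sin (u / 2)|`. -/
noncomputable def logTwoSin (u : ℝ) : ℝ := Real.log |2 * Real.sin (u / 2)|

lemma logTwoSin_neg (u : ℝ) : logTwoSin (-u) = logTwoSin u := by
  simp [logTwoSin, neg_div]

lemma intervalIntegrable_logTwoSin (a b : ℝ) : IntervalIntegrable logTwoSin volume a b := by
  have : MeromorphicOn (fun u : ℝ => 2 * Real.sin (u / 2)) (Set.uIcc a b) := by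
    apply AnalyticOnNhd.meromorphicOn
    intro x _
    fun_prop
  exact this.intervalIntegrable_log_norm

lemma intervalIntegrable_log_abs_cos_sub_cos (θ a b : ℝ) :
    IntervalIntegrable (fun φ => Real.log |Real.cos θ - Real.cos φ|) volume a b := by
  have : MeromorphicOn (fun φ : ℝ => Real.cos θ - Real.cos φ) (Set.uIcc a b) := by
    apply AnalyticOnNhd.meromorphicOn
    intro x _
    fun_prop
  exact this.intervalIntegrable_log_norm

/-- The quotient of `sin (n u)` by `sin (u / 2)`. -/
noncomputable def sinQuotient (n : ℕ) (u : ℝ) : ℝ :=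
  ∑ k ∈ Finset.range n, 2 * Real.cos ((k + 1 / 2) * u)

lemma sin_half_mul_sinQuotient (n : ℕ) (u : ℝ) :
    Real.sin (u / 2) * sinQuotient n u = Real.sin (n * u) := by
  have h : ∀ k : ℕ, Real.sin (u / 2) * (2 * Real.cos ((k + 1 / 2) * u)) =
      Real.sin ((k + 1 : ℕ) * u) - Real.sin (k * u) := by
    intro k
    have h1 : ((k + 1 : ℕ) : ℝ) * u = (k + 1 / 2) * u + u / 2 := by push_cast; ring
    have h2 : (k : ℝ) * u = (k + 1 / 2) * u - u / 2 := by ring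
    rw [h1, h2, Real.sin_add, Real.sin_sub]
    ring
  rw [sinQuotient, Finset.mul_sum, Finset.sum_congr rfl fun k _ => h k,
    Finset.sum_range_sub (fun k : ℕ => Real.sin (k * u))]
  simp

lemma continuous_sinQuotient (n : ℕ) : Continuous (sinQuotient n) := by
  unfold sinQuotient
  fun_prop

lemma integral_cos_nat_mul (k : ℕ) (hk : k ≠ 0) : ∫ u in 0..Real.pi, Real.cos (k * u) = 0 := by
  have hk' : (k : ℝ) ≠ 0 := Nat.cast_ne_zero.mpr hk
  rw [intervalIntegral.integral_comp_mul_left (fun x => Real.cos x) hk']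
  simp

/-- The product formula turns each summand into `cos ((k + 1) u) + cos (k u)`; only the constant
`cos (0 u)` has a nonzero integral. -/
lemma integral_cos_half_mul_sinQuotient (n : ℕ) :
    ∫ u in 0..Real.pi, Real.cos (u / 2) * sinQuotient (n + 1) u = Real.pi := by
  have h : ∀ u, Real.cos (u / 2) * sinQuotient (n + 1) u =
      ∑ k ∈ Finset.range (n + 1), (Real.cos ((k + 1 : ℕ) * u) + Real.cos (k * u)) := by
    intro u
    rw [sinQuotient, Finset.mul_sum]
    refine Finset.sum_congr rfl fun k _ => ?_
    have h1 : ((k + 1 : ℕ) : ℝ) * u = (k + 1 / 2) * u + u / 2 := by push_cast; ring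
    have h2 : (k : ℝ) * u = (k + 1 / 2) * u - u / 2 := by ring
    rw [h1, h2, Real.cos_add, Real.cos_sub]
    ring
  simp_rw [h]
  rw [intervalIntegral.integral_finsetSum
    (fun k _ => (Continuous.intervalIntegrable (by fun_prop) _ _)), Finset.sum_range_succ']
  have h0 : ∀ k : ℕ, ∫ u in 0..Real.pi, (Real.cos ((k + 1 : ℕ) * u) + Real.cos (k * u)) =
      ∫ u in 0..Real.pi, Real.cos (k * u) := by
    intro k
    rw [intervalIntegral.integral_add (Continuous.intervalIntegrable (by fun_prop) _ _)
      (Continuous.intervalIntegrable (by fun_prop) _ _),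
      integral_cos_nat_mul _ (Nat.succ_ne_zero k), zero_add]
  simp_rw [h0]
  rw [Finset.sum_eq_zero fun k _ => integral_cos_nat_mul _ (Nat.succ_ne_zero k)]
  simp

/-- Integration by parts with `logTwoSin u * sin (N u)`, which vanishes at both ends. The
singularity at `0` is harmless because `sin (N u)` is divisible by `sin (u / 2)`; the cotangent term
becomes `cos (u / 2) * sinQuotient`. -/
lemma integral_logTwoSin_mul_cos (n : ℕ) :
    ∫ u in 0..Real.pi, logTwoSin u * Real.cos ((n + 1 : ℕ) * u) =
      -(Real.pi / (2 * (n + 1 : ℕ))) := by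
  set N : ℝ := ((n + 1 : ℕ) : ℝ) with hN
  have hN0 : N ≠ 0 := by positivity
  -- Continuity up to `u = 0` comes from that of `x log x` at `0`.
  have hcont : Continuous fun u => logTwoSin u * Real.sin (N * u) := by
    have h : (fun u => logTwoSin u * Real.sin (N * u)) = fun u =>
        (1 / 2) * ((2 * Real.sin (u / 2)) * Real.log (2 * Real.sin (u / 2))) *
          sinQuotient (n + 1) u := by
      funext u
      rw [hN, ← sin_half_mul_sinQuotient, logTwoSin, Real.log_abs]
      ring
    rw [h]
    have h1 : Continuous fun u : ℝ =>
        (2 * Real.sin (u / 2)) * Real.log (2 * Real.sin (u / 2)) :=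
      Real.continuous_mul_log.comp (by fun_prop)
    exact (continuous_const.mul h1).mul (continuous_sinQuotient _)
  have hi1 : IntervalIntegrable (fun u => logTwoSin u * Real.cos (N * u)) volume 0 Real.pi :=
    (intervalIntegrable_logTwoSin _ _).mul_continuousOn (by fun_prop)
  have hi2 : IntervalIntegrable (fun u => Real.cos (u / 2) * sinQuotient (n + 1) u)
      volume 0 Real.pi :=
    ((by fun_prop : Continuous fun u : ℝ => Real.cos (u / 2)).mul
      (continuous_sinQuotient _)).intervalIntegrable _ _
  have hderiv : ∀ u ∈ Set.Ioo 0 Real.pi, HasDerivAt (fun u => logTwoSin u * Real.sin (N * u))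
      ((1 / 2) * (Real.cos (u / 2) * sinQuotient (n + 1) u) +
        N * (logTwoSin u * Real.cos (N * u))) u := by
    intro u hu
    have hs : 0 < Real.sin (u / 2) :=
      Real.sin_pos_of_pos_of_lt_pi (by linarith [hu.1]) (by linarith [hu.1, hu.2])
    have h1 : HasDerivAt (fun u : ℝ => 2 * Real.sin (u / 2))
        (2 * (Real.cos (u / 2) * (1 / 2))) u :=
      (((hasDerivAt_id u).div_const 2).sin).const_mul 2
    have h2 : HasDerivAt logTwoSin (2 * (Real.cos (u / 2) * (1 / 2)) / (2 * Real.sin (u / 2))) u := by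
      have := h1.log (by positivity)
      refine this.congr_of_eventuallyEq (Filter.Eventually.of_forall fun v => ?_)
      rw [logTwoSin, Real.log_abs]
    have h3 : HasDerivAt (fun u : ℝ => Real.sin (N * u)) (Real.cos (N * u) * (N * 1)) u :=
      ((hasDerivAt_id u).const_mul N).sin
    refine (h2.mul h3).congr_deriv ?_
    rw [← sin_half_mul_sinQuotient (n + 1) u]
    field_simp
  have h := integral_eq_sub_of_hasDerivAt_of_le Real.pi_pos.le hcont.continuousOn hderiv
    ((hi2.const_mul _).add (hi1.const_mul _))
  rw [intervalIntegral.integral_add (hi2.const_mul _) (hi1.const_mul _),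
    intervalIntegral.integral_const_mul, intervalIntegral.integral_const_mul,
    integral_cos_half_mul_sinQuotient] at h
  have hp : Real.sin (N * Real.pi) = 0 := Real.sin_nat_mul_pi _
  simp only [hp, mul_zero, Real.sin_zero, sub_zero] at h
  field_simp
  linarith

/-- Halving the variable leads to Euler's integral of `log sin` over `[0, π / 2]`, which the `log 2`
from the factor `2` cancels exactly. -/
lemma integral_logTwoSin : ∫ u in 0..Real.pi, logTwoSin u = 0 := by
  have h1 : ∀ᵐ u : ℝ, u ∈ Set.uIoc 0 (Real.pi / 2) → Real.log |2 * Real.sin u| =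
      Real.log 2 + Real.log (Real.sin u) := by
    refine Filter.Eventually.of_forall fun u hu => ?_
    rw [Set.uIoc_of_le (by positivity)] at hu
    have hs : 0 < Real.sin u :=
      Real.sin_pos_of_pos_of_lt_pi hu.1 (by linarith [hu.2, Real.pi_pos])
    rw [Real.log_abs, Real.log_mul two_ne_zero hs.ne']
  have h2 := intervalIntegral.integral_comp_div (a := 0) (b := Real.pi)
    (fun u => Real.log |2 * Real.sin u|) two_ne_zero
  simp only [logTwoSin, h2, zero_div]
  rw [intervalIntegral.integral_congr_ae h1,
    intervalIntegral.integral_add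
    intervalIntegrable_const (by exact intervalIntegrable_log_sin), integral_log_sin_zero_pi_div_two]
  simp
  ring

lemma integral_neg_pi_pi_of_even {f : ℝ → ℝ} (hf : ∀ u, f (-u) = f u)
    (hi : ∀ a b, IntervalIntegrable f volume a b) :
    ∫ u in (-Real.pi)..Real.pi, f u = 2 * ∫ u in 0..Real.pi, f u := by
  rw [← intervalIntegral.integral_add_adjacent_intervals (hi _ 0) (hi 0 _)]
  have := intervalIntegral.integral_comp_neg (a := 0) (b := Real.pi) f
  simp only [hf, neg_zero] at this
  rw [← this]
  ring

lemma integral_neg_pi_pi_of_odd {f : ℝ → ℝ} (hf : ∀ u, f (-u) = -f u) :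
    ∫ u in (-Real.pi)..Real.pi, f u = 0 := by
  have := intervalIntegral.integral_comp_neg (a := -Real.pi) (b := Real.pi) f
  simp only [hf, neg_neg, intervalIntegral.integral_neg] at this
  linarith

lemma logTwoSin_add_two_pi (u : ℝ) : logTwoSin (u + 2 * Real.pi) = logTwoSin u := by
  rw [logTwoSin, logTwoSin, show (u + 2 * Real.pi) / 2 = u / 2 + Real.pi by ring, Real.sin_add_pi]
  simp

/-- Discards the countable set on which the convention `Real.log 0 = 0` would spoil the logarithm of
a product. -/
lemma ae_cos_ne (x : ℝ) : ∀ᵐ φ : ℝ, Real.cos φ ≠ x := by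
  by_cases hx : ∃ θ, Real.cos θ = x
  · obtain ⟨θ, rfl⟩ := hx
    have hc : ({φ : ℝ | Real.cos φ = Real.cos θ}).Countable := by
      have : {φ : ℝ | Real.cos φ = Real.cos θ} ⊆
          (Set.range fun k : ℤ => 2 * k * Real.pi + θ) ∪
            Set.range fun k : ℤ => 2 * k * Real.pi - θ := by
        intro φ hφ
        obtain ⟨k, hk | hk⟩ := Real.cos_eq_cos_iff.mp (show Real.cos θ = Real.cos φ from hφ.symm)
        · exact Or.inl ⟨k, hk.symm⟩
        · exact Or.inr ⟨k, hk.symm⟩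
      exact ((Set.countable_range _).union (Set.countable_range _)).mono this
    have := hc.ae_notMem (volume : Measure ℝ)
    filter_upwards [this] with φ hφ h using hφ h
  · exact Filter.Eventually.of_forall fun φ h => hx ⟨φ, h⟩

lemma log_abs_cos_sub_cos {θ φ : ℝ} (h : Real.cos φ ≠ Real.cos θ) :
    Real.log |Real.cos θ - Real.cos φ| =
      logTwoSin (φ + θ) + logTwoSin (φ - θ) - Real.log 2 := by
  have h1 : Real.cos θ - Real.cos φ =
      (2 * Real.sin ((φ + θ) / 2)) * (2 * Real.sin ((φ - θ) / 2)) / 2 := by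
    rw [Real.cos_sub_cos, show (θ - φ) / 2 = -((φ - θ) / 2) by ring, Real.sin_neg, add_comm θ]
    ring
  have h2 : Real.cos θ - Real.cos φ ≠ 0 := sub_ne_zero.mpr h.symm
  rw [h1] at h2 ⊢
  have h3 : 2 * Real.sin ((φ + θ) / 2) ≠ 0 := by
    intro h0; simp [h0] at h2
  have h4 : 2 * Real.sin ((φ - θ) / 2) ≠ 0 := by
    intro h0; simp [h0] at h2
  rw [Real.log_abs, Real.log_div (mul_ne_zero h3 h4) two_ne_zero, Real.log_mul h3 h4, logTwoSin,
    logTwoSin, Real.log_abs, Real.log_abs]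

/-- Reflecting the first summand unfolds the half circle to the full circle. Periodicity then
removes the shift by `θ`, and in the expansion of `cos (n (u + θ))` the sine part is odd and drops
out. -/
lemma integral_logTwoSin_shift (n : ℕ) (θ : ℝ) :
    ∫ φ in 0..Real.pi, (logTwoSin (φ + θ) + logTwoSin (φ - θ)) * Real.cos (n * φ) =
      2 * Real.cos (n * θ) * ∫ u in 0..Real.pi, logTwoSin u * Real.cos (n * u) := by
  have hi : ∀ t a b, IntervalIntegrable (fun φ => logTwoSin (φ + t) * Real.cos (n * φ))
      volume a b := by
    intro t a b
    have h := (intervalIntegrable_logTwoSin (a + t) (b + t)).comp_add_right t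
    simp only [add_sub_cancel_right] at h
    exact h.mul_continuousOn (by fun_prop)
  have hi' : ∀ a b, IntervalIntegrable (fun φ => logTwoSin (φ - θ) * Real.cos (n * φ))
      volume a b := fun a b => by simpa only [sub_eq_add_neg] using hi (-θ) a b
  have hneg : ∫ φ in 0..Real.pi, logTwoSin (φ + θ) * Real.cos (n * φ) =
      ∫ φ in (-Real.pi)..0, logTwoSin (φ - θ) * Real.cos (n * φ) := by
    have := intervalIntegral.integral_comp_neg (a := 0) (b := Real.pi)
      (fun φ => logTwoSin (φ - θ) * Real.cos (n * φ))
    rw [neg_zero] at this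
    rw [← this]
    refine intervalIntegral.integral_congr fun φ _ => ?_
    rw [← logTwoSin_neg (φ + θ), show -(φ + θ) = -φ - θ by ring, mul_neg, Real.cos_neg]
  have hshift : ∫ φ in (-Real.pi)..Real.pi, logTwoSin (φ - θ) * Real.cos (n * φ) =
      ∫ u in (-Real.pi)..Real.pi, logTwoSin u * Real.cos (n * (u + θ)) := by
    have hper : Function.Periodic (fun u => logTwoSin u * Real.cos (n * (u + θ)))
        (2 * Real.pi) := by
      intro u
      simp only
      rw [logTwoSin_add_two_pi, show (n : ℝ) * (u + 2 * Real.pi + θ) =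
        n * (u + θ) + n * (2 * Real.pi) by ring, Real.cos_add_nat_mul_two_pi]
    have h1 := intervalIntegral.integral_comp_sub_right (a := -Real.pi) (b := Real.pi)
      (fun u => logTwoSin u * Real.cos (n * (u + θ))) θ
    simp only [sub_add_cancel] at h1
    rw [h1]
    have h2 := hper.intervalIntegral_add_eq (-Real.pi - θ) (-Real.pi)
    rw [show -Real.pi - θ + 2 * Real.pi = Real.pi - θ by ring,
      show -Real.pi + 2 * Real.pi = Real.pi by ring] at h2
    exact h2
  have hc : ∀ a b, IntervalIntegrable (fun u => logTwoSin u * Real.cos (n * u)) volume a b :=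
    fun a b => (intervalIntegrable_logTwoSin a b).mul_continuousOn (by fun_prop)
  have hs : ∀ a b, IntervalIntegrable (fun u => logTwoSin u * Real.sin (n * u)) volume a b :=
    fun a b => (intervalIntegrable_logTwoSin a b).mul_continuousOn (by fun_prop)
  have hsplit : ∀ u, logTwoSin u * Real.cos (n * (u + θ)) =
      Real.cos (n * θ) * (logTwoSin u * Real.cos (n * u)) -
        Real.sin (n * θ) * (logTwoSin u * Real.sin (n * u)) := by
    intro u
    rw [mul_add, Real.cos_add]
    ring
  simp_rw [add_mul]
  rw [intervalIntegral.integral_add (hi θ _ _) (hi' _ _), hneg,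
    intervalIntegral.integral_add_adjacent_intervals (hi' _ _) (hi' _ _), hshift]
  simp_rw [hsplit]
  rw [intervalIntegral.integral_sub ((hc _ _).const_mul _) ((hs _ _).const_mul _),
    intervalIntegral.integral_const_mul, intervalIntegral.integral_const_mul,
    integral_neg_pi_pi_of_even (fun u => by simp [logTwoSin_neg]) hc,
    integral_neg_pi_pi_of_odd (fun u => by simp [logTwoSin_neg])]
  ring

lemma integral_log_abs_cos_sub_cos_mul_cos (n : ℕ) (θ : ℝ) :
    ∫ φ in 0..Real.pi, Real.log |Real.cos θ - Real.cos φ| * Real.cos (n * φ) =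
      2 * Real.cos (n * θ) * (∫ u in 0..Real.pi, logTwoSin u * Real.cos (n * u)) -
        Real.log 2 * ∫ φ in 0..Real.pi, Real.cos (n * φ) := by
  have hi : ∀ t, IntervalIntegrable (fun φ => logTwoSin (φ + t)) volume 0 Real.pi := by
    intro t
    have h := (intervalIntegrable_logTwoSin (0 + t) (Real.pi + t)).comp_add_right t
    simpa only [add_sub_cancel_right] using h
  rw [← integral_logTwoSin_shift, ← intervalIntegral.integral_const_mul,
    ← intervalIntegral.integral_sub]
  · refine intervalIntegral.integral_congr_ae ?_
    filter_upwards [ae_cos_ne (Real.cos θ)] with φ hφ _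
    rw [log_abs_cos_sub_cos hφ]
    ring
  · exact ((hi θ).add (by simpa only [sub_eq_add_neg] using hi (-θ))).mul_continuousOn
      (by fun_prop)
  · exact Continuous.intervalIntegrable (by fun_prop) _ _

lemma integral_log_abs_cos_sub_cos (θ : ℝ) :
    ∫ φ in 0..Real.pi, Real.log |Real.cos θ - Real.cos φ| = -(Real.pi * Real.log 2) := by
  have := integral_log_abs_cos_sub_cos_mul_cos 0 θ
  simp only [Nat.cast_zero, zero_mul, Real.cos_zero, mul_one, integral_logTwoSin] at this
  rw [this]
  simp
  ring

lemma integral_log_abs_cos_sub_cos_mul_cos_succ (n : ℕ) (θ : ℝ) :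
    ∫ φ in 0..Real.pi, Real.log |Real.cos θ - Real.cos φ| * Real.cos ((n + 1 : ℕ) * φ) =
      -(Real.pi / (n + 1 : ℕ)) * Real.cos ((n + 1 : ℕ) * θ) := by
  rw [integral_log_abs_cos_sub_cos_mul_cos, integral_logTwoSin_mul_cos,
    integral_cos_nat_mul _ n.succ_ne_zero]
  field_simp
  ring

/-- For `0 < B < A`, the mean over the half circle of `log (A² + B² + 2 A B cos φ)`. -/
lemma integral_log_add_cos {A B : ℝ} (hB : 0 < B) (hAB : B < A) :
    ∫ φ in 0..Real.pi, Real.log (A ^ 2 + B ^ 2 + 2 * A * B * Real.cos φ) =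
      Real.pi * (2 * Real.log A) := by
  have hA : 0 < A := hB.trans hAB
  have hpos : ∀ φ, 0 < A ^ 2 + B ^ 2 + 2 * A * B * Real.cos φ := by
    intro φ
    have := Real.neg_one_le_cos φ
    have h2 : 0 < (A - B) ^ 2 := by have := sub_pos.mpr hAB; positivity
    nlinarith [mul_pos hA hB]
  -- The integrand is `2 log |A + B exp (iφ)|`; as `B < A`, the point `-A` lies outside the circle
  -- and the mean of `log |z + A|` is `log A`.
  have h := circleAverage_log_norm_sub_const_eq_log_radius_add_posLog (R := B) (c := 0)
    (a := ((-A : ℝ) : ℂ)) hB.ne'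
  have h1 : B⁻¹ * ‖(0 : ℂ) - ((-A : ℝ) : ℂ)‖ = A / B := by
    rw [zero_sub, norm_neg, Complex.norm_real, Real.norm_eq_abs, abs_neg, abs_of_pos hA]
    field_simp
  rw [h1, Real.posLog_eq_log (by rw [abs_of_pos (by positivity), le_div_iff₀ hB]; linarith),
    Real.log_div hA.ne' hB.ne', add_sub_cancel, Real.circleAverage_def] at h
  have h2 : ∀ φ : ℝ, Real.log ‖circleMap 0 B φ - ((-A : ℝ) : ℂ)‖ =
      (1 / 2) * Real.log (A ^ 2 + B ^ 2 + 2 * A * B * Real.cos φ) := by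
    intro φ
    have h3 : ‖circleMap 0 B φ - ((-A : ℝ) : ℂ)‖ ^ 2 =
        A ^ 2 + B ^ 2 + 2 * A * B * Real.cos φ := by
      rw [← Complex.normSq_eq_norm_sq, Complex.normSq_apply, circleMap]
      simp [Complex.exp_ofReal_mul_I_re, Complex.exp_ofReal_mul_I_im]
      nlinarith [Real.sin_sq_add_cos_sq φ]
    rw [← h3, Real.log_pow]
    push_cast
    ring
  simp_rw [h2] at h
  have hcont : Continuous fun φ : ℝ => Real.log (A ^ 2 + B ^ 2 + 2 * A * B * Real.cos φ) :=
    Continuous.log (by fun_prop) fun φ => (hpos φ).ne'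
  have hper : Function.Periodic
      (fun φ : ℝ => Real.log (A ^ 2 + B ^ 2 + 2 * A * B * Real.cos φ)) (2 * Real.pi) := by
    intro φ
    simp
  have h4 := hper.intervalIntegral_add_eq 0 (-Real.pi)
  rw [zero_add, show -Real.pi + 2 * Real.pi = Real.pi by ring,
    integral_neg_pi_pi_of_even (fun u => by simp) (fun a b => hcont.intervalIntegrable a b)] at h4
  rw [intervalIntegral.integral_const_mul, h4, smul_eq_mul] at h
  have := Real.pi_pos
  field_simp at h
  linarith

/-! ### The arcsine law as the image of a uniform angle, and its potential. -/

/-- The parametrisation of `[a, b]` by the angle of the half circle above it. -/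
noncomputable def cosParam (a b φ : ℝ) : ℝ := (a + b) / 2 + (b - a) / 2 * Real.cos φ

lemma continuous_cosParam (a b : ℝ) : Continuous (cosParam a b) := by
  unfold cosParam
  fun_prop

lemma exists_cosParam_eq {a b x : ℝ} (hab : a < b) (hx : x ∈ Set.Icc a b) :
    ∃ θ, cosParam a b θ = x := by
  have hr : 0 < b - a := sub_pos.mpr hab
  refine ⟨Real.arccos ((x - (a + b) / 2) / ((b - a) / 2)), ?_⟩
  rw [cosParam, Real.cos_arccos]
  · field_simp
    ring
  · rw [le_div_iff₀ (by linarith)]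
    linarith [hx.1]
  · rw [div_le_one (by linarith)]
    linarith [hx.2]

lemma injOn_cosParam {a b : ℝ} (hab : a < b) : Set.InjOn (cosParam a b) (Set.Ioo 0 Real.pi) := by
  intro x hx y hy h
  have hr : (b - a) / 2 ≠ 0 := by linarith [sub_pos.mpr hab] |> fun h : 0 < (b - a) / 2 => h.ne'
  exact Real.injOn_cos (Set.Ioo_subset_Icc_self hx) (Set.Ioo_subset_Icc_self hy)
    (mul_left_cancel₀ hr (add_left_cancel h))

lemma cosParam_mem_Ioo {a b φ : ℝ} (hab : a < b) (hφ : φ ∈ Set.Ioo 0 Real.pi) :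
    cosParam a b φ ∈ Set.Ioo a b := by
  have h1 : Real.cos φ < 1 := by
    have := Real.strictAntiOn_cos (Set.left_mem_Icc.mpr Real.pi_pos.le)
      (Set.Ioo_subset_Icc_self hφ) hφ.1
    simpa using this
  have h2 : -1 < Real.cos φ := by
    have := Real.strictAntiOn_cos (Set.Ioo_subset_Icc_self hφ)
      (Set.right_mem_Icc.mpr Real.pi_pos.le) hφ.2
    simpa using this
  unfold cosParam
  constructor <;> nlinarith

lemma image_cosParam {a b : ℝ} (hab : a < b) :
    cosParam a b '' Set.Ioo 0 Real.pi = Set.Ioo a b := by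
  refine Set.Subset.antisymm (Set.image_subset_iff.mpr fun φ hφ => cosParam_mem_Ioo hab hφ) ?_
  have h := intermediate_value_Ioo' Real.pi_pos.le (continuous_cosParam a b).continuousOn
  have h0 : cosParam a b 0 = b := by simp [cosParam]; ring
  have hp : cosParam a b Real.pi = a := by simp [cosParam]; ring
  rwa [h0, hp] at h

/-- With `r = (b - a) / 2`, both the Jacobian and `√((b - x) (x - a))` equal `r sin φ`, so the
density becomes the constant `1 / π` in the angle. -/
lemma arcsineMeasure_eq_map {a b : ℝ} (hab : a < b) :
    arcsineMeasure a b =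
      (ENNReal.ofReal Real.pi⁻¹ • volume.restrict (Set.Ioo 0 Real.pi)).map (cosParam a b) := by
  ext s hs
  have hm : Measurable (cosParam a b) := (continuous_cosParam a b).measurable
  have hd : ∀ φ ∈ Set.Ioo 0 Real.pi, HasDerivWithinAt (cosParam a b)
      ((b - a) / 2 * (-Real.sin φ)) (Set.Ioo 0 Real.pi) φ := fun φ _ =>
    (((Real.hasDerivAt_cos φ).const_mul _).const_add _).hasDerivWithinAt
  have h1 : arcsineMeasure a b s = ∫⁻ x in Set.Ioo a b,
      ENNReal.ofReal (1 / (Real.pi * Real.sqrt ((b - x) * (x - a)))) * s.indicator 1 x := by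
    rw [arcsineMeasure, withDensity_apply _ hs, ← lintegral_indicator hs,
      ← lintegral_indicator measurableSet_Ioo]
    refine lintegral_congr fun x => ?_
    by_cases hx : x ∈ s <;> by_cases hx' : x ∈ Set.Ioo a b <;> simp [hx, hx']
  rw [h1, ← image_cosParam hab, lintegral_image_eq_lintegral_abs_deriv_mul measurableSet_Ioo hd
    (injOn_cosParam hab), Measure.map_apply hm hs, Measure.smul_apply, smul_eq_mul,
    ← lintegral_indicator_one (hm hs), ← lintegral_const_mul _ (by
      exact measurable_one.indicator (hm hs))]
  refine setLIntegral_congr_fun measurableSet_Ioo fun φ hφ => ?_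
  have hsin : 0 < Real.sin φ := Real.sin_pos_of_mem_Ioo hφ
  have hr : 0 < (b - a) / 2 := by linarith
  have h2 : (b - cosParam a b φ) * (cosParam a b φ - a) = ((b - a) / 2 * Real.sin φ) ^ 2 := by
    have := Real.sin_sq_add_cos_sq φ
    rw [mul_pow, show Real.sin φ ^ 2 = 1 - Real.cos φ ^ 2 by linarith, cosParam]
    ring
  rw [h2, Real.sqrt_sq (by positivity), ← mul_assoc, ← ENNReal.ofReal_mul (abs_nonneg _),
    mul_neg, abs_neg, abs_of_pos (by positivity)]
  congr 1
  generalize (b - a) / 2 = r at hr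
  congr 1
  field_simp

lemma isProbabilityMeasure_arcsineMeasure {a b : ℝ} (hab : a < b) :
    IsProbabilityMeasure (arcsineMeasure a b) := by
  constructor
  rw [arcsineMeasure_eq_map hab, Measure.map_apply (continuous_cosParam a b).measurable
    MeasurableSet.univ]
  simp only [Set.preimage_univ, Measure.smul_apply, Measure.restrict_apply_univ, Real.volume_Ioo,
    sub_zero, smul_eq_mul]
  rw [← ENNReal.ofReal_mul (by positivity), inv_mul_cancel₀ Real.pi_ne_zero, ENNReal.ofReal_one]

lemma arcsineMeasure_compl_Ioo (a b : ℝ) : arcsineMeasure a b (Set.Ioo a b)ᶜ = 0 := by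
  rw [arcsineMeasure, withDensity_apply _ measurableSet_Ioo.compl]
  rw [setLIntegral_congr_fun (g := fun _ => 0) measurableSet_Ioo.compl, lintegral_zero]
  intro x hx
  simp [Set.indicator_of_notMem hx]

lemma arcsineMeasure_mem_mixedStrategies {a b : ℝ} (hab : a < b) :
    arcsineMeasure a b ∈ mixedStrategies a b :=
  ⟨isProbabilityMeasure_arcsineMeasure hab, measure_mono_null
    (Set.compl_subset_compl.mpr Set.Ioo_subset_Icc_self) (arcsineMeasure_compl_Ioo a b)⟩

instance nullSingletonClass_arcsineMeasure (a b : ℝ) : NullSingletonClass (arcsineMeasure a b) := by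
  unfold arcsineMeasure
  infer_instance

lemma integral_arcsineMeasure {a b : ℝ} (hab : a < b) {f : ℝ → ℝ} (hf : Measurable f) :
    ∫ x, f x ∂(arcsineMeasure a b) = Real.pi⁻¹ * ∫ φ in 0..Real.pi, f (cosParam a b φ) := by
  rw [arcsineMeasure_eq_map hab, integral_map (continuous_cosParam a b).aemeasurable
    hf.aestronglyMeasurable, MeasureTheory.integral_smul_measure, intervalIntegral.integral_of_le
    Real.pi_pos.le, integral_Ioc_eq_integral_Ioo,
    ENNReal.toReal_ofReal (inv_nonneg.mpr Real.pi_pos.le), smul_eq_mul]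

lemma integrable_arcsineMeasure {a b : ℝ} (hab : a < b) {f : ℝ → ℝ} (hf : Measurable f)
    (hi : IntervalIntegrable (fun φ => f (cosParam a b φ)) volume 0 Real.pi) :
    Integrable f (arcsineMeasure a b) := by
  rw [arcsineMeasure_eq_map hab, integrable_map_measure hf.aestronglyMeasurable
    (continuous_cosParam a b).aemeasurable]
  refine Integrable.smul_measure ?_ ENNReal.ofReal_ne_top
  rw [intervalIntegrable_iff_integrableOn_Ioo_of_le Real.pi_pos.le] at hi
  exact hi

lemma measurable_log_abs_sub (x : ℝ) : Measurable fun y : ℝ => Real.log |x - y| := by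
  fun_prop

lemma ae_log_abs_cosParam_sub {a b : ℝ} (hab : a < b) (θ : ℝ) : ∀ᵐ φ : ℝ,
    Real.log |cosParam a b θ - cosParam a b φ| =
      Real.log ((b - a) / 2) + Real.log |Real.cos θ - Real.cos φ| := by
  filter_upwards [ae_cos_ne (Real.cos θ)] with φ hφ
  have hr : 0 < (b - a) / 2 := by linarith
  rw [show cosParam a b θ - cosParam a b φ = (b - a) / 2 * (Real.cos θ - Real.cos φ) by
    unfold cosParam; ring, abs_mul, abs_of_pos hr,
    Real.log_mul hr.ne' (abs_ne_zero.mpr (sub_ne_zero.mpr hφ.symm))]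

lemma integrable_log_abs_sub_arcsineMeasure {a b x : ℝ} (hab : a < b) (hx : x ∈ Set.Icc a b) :
    Integrable (fun y => Real.log |x - y|) (arcsineMeasure a b) := by
  obtain ⟨θ, rfl⟩ := exists_cosParam_eq hab hx
  refine integrable_arcsineMeasure hab (measurable_log_abs_sub _) ?_
  refine (intervalIntegrable_const.add
    (intervalIntegrable_log_abs_cos_sub_cos θ 0 Real.pi)).congr_ae
    (f := fun φ => Real.log ((b - a) / 2) + Real.log |Real.cos θ - Real.cos φ|) ?_
  refine ae_restrict_of_ae ?_
  filter_upwards [ae_log_abs_cosParam_sub hab θ] with φ hφ using hφ.symm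

/-- The logarithmic potential of the arcsine distribution is constant on its support. -/
lemma integral_log_abs_sub_arcsineMeasure {a b x : ℝ} (hab : a < b) (hx : x ∈ Set.Icc a b) :
    ∫ y, Real.log |x - y| ∂(arcsineMeasure a b) = Real.log ((b - a) / 4) := by
  obtain ⟨θ, rfl⟩ := exists_cosParam_eq hab hx
  have hba : 0 < b - a := sub_pos.mpr hab
  rw [integral_arcsineMeasure hab (measurable_log_abs_sub _), intervalIntegral.integral_congr_ae
    ((ae_log_abs_cosParam_sub hab θ).mono fun φ h _ => h), intervalIntegral.integral_add
    intervalIntegrable_const (intervalIntegrable_log_abs_cos_sub_cos θ 0 Real.pi),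
    integral_log_abs_cos_sub_cos, intervalIntegral.integral_const, smul_eq_mul, sub_zero,
    show (b - a) / 4 = (b - a) / 2 / 2 by ring, Real.log_div (x := (b - a) / 2) (by positivity) two_ne_zero]
  generalize Real.log ((b - a) / 2) = L
  have := Real.pi_ne_zero
  field_simp
  ring

/-! ### Chebyshev polynomials and the logarithmic kernel. -/

/-- The Chebyshev polynomial transported to `[a, b]`. -/
noncomputable def shiftedChebyshev (a b : ℝ) (n : ℕ) (x : ℝ) : ℝ :=
  (Chebyshev.T ℝ n).eval ((x - (a + b) / 2) / ((b - a) / 2))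

lemma continuous_shiftedChebyshev (a b : ℝ) (n : ℕ) : Continuous (shiftedChebyshev a b n) := by
  unfold shiftedChebyshev
  fun_prop

lemma shiftedChebyshev_cosParam {a b : ℝ} (hab : a < b) (n : ℕ) (φ : ℝ) :
    shiftedChebyshev a b n (cosParam a b φ) = Real.cos (n * φ) := by
  have hba : b - a ≠ 0 := (sub_pos.mpr hab).ne'
  rw [shiftedChebyshev, show (cosParam a b φ - (a + b) / 2) / ((b - a) / 2) = Real.cos φ by
    unfold cosParam; field_simp; ring, Chebyshev.T_real_cos]
  simp

lemma abs_shiftedChebyshev_le {a b x : ℝ} (hab : a < b) (n : ℕ) (hx : x ∈ Set.Icc a b) :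
    |shiftedChebyshev a b n x| ≤ 1 := by
  obtain ⟨θ, rfl⟩ := exists_cosParam_eq hab hx
  rw [shiftedChebyshev_cosParam hab]
  exact Real.abs_cos_le_one _

lemma integral_shiftedChebyshev_arcsineMeasure {a b : ℝ} (hab : a < b) (n : ℕ) :
    ∫ y, shiftedChebyshev a b (n + 1) y ∂(arcsineMeasure a b) = 0 := by
  rw [integral_arcsineMeasure hab (continuous_shiftedChebyshev a b _).measurable]
  simp_rw [shiftedChebyshev_cosParam hab]
  rw [integral_cos_nat_mul _ n.succ_ne_zero, mul_zero]

/-- The Chebyshev polynomials are eigenfunctions of the logarithmic kernel. -/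
lemma integral_log_abs_sub_mul_shiftedChebyshev {a b x : ℝ} (hab : a < b) (hx : x ∈ Set.Icc a b)
    (n : ℕ) :
    ∫ y, Real.log |x - y| * shiftedChebyshev a b (n + 1) y ∂(arcsineMeasure a b) =
      -(1 / (n + 1 : ℕ)) * shiftedChebyshev a b (n + 1) x := by
  obtain ⟨θ, rfl⟩ := exists_cosParam_eq hab hx
  have hm : Measurable fun y =>
      Real.log |cosParam a b θ - y| * shiftedChebyshev a b (n + 1) y :=
    (measurable_log_abs_sub _).mul (continuous_shiftedChebyshev a b _).measurable
  rw [integral_arcsineMeasure hab hm]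
  simp_rw [shiftedChebyshev_cosParam hab]
  -- The scaling constant `log ((b - a) / 2)` contributes nothing, since the cosine has mean zero.
  have h : ∀ᵐ φ : ℝ, φ ∈ Set.uIoc 0 Real.pi →
      Real.log |cosParam a b θ - cosParam a b φ| * Real.cos ((n + 1 : ℕ) * φ) =
      Real.log ((b - a) / 2) * Real.cos ((n + 1 : ℕ) * φ) +
        Real.log |Real.cos θ - Real.cos φ| * Real.cos ((n + 1 : ℕ) * φ) := by
    filter_upwards [ae_log_abs_cosParam_sub hab θ] with φ hφ _
    rw [hφ, add_mul]
  rw [intervalIntegral.integral_congr_ae h, intervalIntegral.integral_add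
    (Continuous.intervalIntegrable (by fun_prop) _ _)
    ((intervalIntegrable_log_abs_cos_sub_cos θ 0 Real.pi).mul_continuousOn (by fun_prop)),
    intervalIntegral.integral_const_mul, integral_cos_nat_mul _ n.succ_ne_zero,
    integral_log_abs_cos_sub_cos_mul_cos_succ]
  have := Real.pi_ne_zero
  field_simp
  ring

lemma integral_log_arcsineMeasure {a b : ℝ} (ha : 0 < a) (hab : a < b) :
    ∫ y, Real.log y ∂(arcsineMeasure a b) = 2 * Real.log ((√b + √a) / 2) := by
  have hsq : √a < √b := Real.sqrt_lt_sqrt ha.le hab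
  have ha' : 0 < √a := Real.sqrt_pos.mpr ha
  have hA := Real.sq_sqrt ha.le
  have hB := Real.sq_sqrt (ha.trans hab).le
  rw [integral_arcsineMeasure hab Real.measurable_log]
  -- These `A`, `B` solve `A² + B² = (a + b) / 2` and `2 A B = (b - a) / 2`, the coefficients of
  -- `cosParam`.
  have h := integral_log_add_cos (A := (√b + √a) / 2) (B := (√b - √a) / 2) (by linarith)
    (by linarith)
  have h1 : ∀ φ, cosParam a b φ = ((√b + √a) / 2) ^ 2 + ((√b - √a) / 2) ^ 2 +
      2 * ((√b + √a) / 2) * ((√b - √a) / 2) * Real.cos φ := by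
    intro φ
    rw [cosParam, show 2 * ((√b + √a) / 2) * ((√b - √a) / 2) = (√b ^ 2 - √a ^ 2) / 2 by ring,
      show ((√b + √a) / 2) ^ 2 + ((√b - √a) / 2) ^ 2 = (√b ^ 2 + √a ^ 2) / 2 by ring, hA, hB]
    ring
  simp_rw [h1]
  rw [h, ← mul_assoc, inv_mul_cancel₀ Real.pi_ne_zero, one_mul]

/-! ### Integrability, Chebyshev moments and uniqueness of the equilibrium measure. -/

/-- The kernel `log |x - y|` is integrable for the product of the arcsine distribution with any
finite measure on the same interval. -/
lemma integrable_log_abs_sub_prod {a b : ℝ} (hab : a < b) (ν : Measure ℝ) [IsFiniteMeasure ν]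
    (hν : ν (Set.Icc a b)ᶜ = 0) :
    Integrable (fun p : ℝ × ℝ => Real.log |p.1 - p.2|) (ν.prod (arcsineMeasure a b)) := by
  have := isProbabilityMeasure_arcsineMeasure hab
  have hν' : ∀ᵐ x ∂ν, x ∈ Set.Icc a b := hν
  have hmeas : AEStronglyMeasurable (fun p : ℝ × ℝ => Real.log |p.1 - p.2|)
      (ν.prod (arcsineMeasure a b)) :=
    (by fun_prop : Measurable fun p : ℝ × ℝ => Real.log |p.1 - p.2|).aestronglyMeasurable
  rw [integrable_prod_iff hmeas]
  refine ⟨hν'.mono fun x hx => integrable_log_abs_sub_arcsineMeasure hab hx, ?_⟩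
  -- The kernel is at most `K` and `0 ≤ K`, so its absolute value is at most `2 K - log |x - y|`,
  -- whose integral is known and independent of `x`.
  set K := max 0 (Real.log (b - a)) with hK
  refine Integrable.of_bound hmeas.norm.integral_prod_right' (2 * K - Real.log ((b - a) / 4)) ?_
  filter_upwards [hν'] with x hx
  rw [Real.norm_of_nonneg (integral_nonneg fun y => norm_nonneg _)]
  have hi := integrable_log_abs_sub_arcsineMeasure hab hx
  calc ∫ y, ‖Real.log |x - y|‖ ∂(arcsineMeasure a b)
      ≤ ∫ y, (2 * K - Real.log |x - y|) ∂(arcsineMeasure a b) := by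
        refine integral_mono_ae hi.norm ((integrable_const _).sub hi) ?_
        have hs : ∀ᵐ y ∂(arcsineMeasure a b), y ∈ Set.Ioo a b := arcsineMeasure_compl_Ioo a b
        filter_upwards [hs] with y hy
        have hle : Real.log |x - y| ≤ K := by
          rcases eq_or_ne (x - y) 0 with h | h
          · simp [h, hK]
          · refine le_max_of_le_right (Real.log_le_log (abs_pos.mpr h) ?_)
            rw [abs_le]
            constructor <;> linarith [hx.1, hx.2, hy.1, hy.2]
        have hK0 : 0 ≤ K := le_max_left _ _
        rw [Real.norm_eq_abs, abs_le]
        constructor <;> linarith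
    _ = 2 * K - Real.log ((b - a) / 4) := by
        rw [integral_sub (integrable_const _) hi, integral_log_abs_sub_arcsineMeasure hab hx]
        simp

lemma integrable_of_continuous_of_mem_mixedStrategies {a b : ℝ} {μ : Measure ℝ}
    (hμ : μ ∈ mixedStrategies a b) {f : ℝ → ℝ} (hf : Continuous f) : Integrable f μ := by
  have := hμ.1
  have hμ' : ∀ᵐ x ∂μ, x ∈ Set.Icc a b := hμ.2
  obtain ⟨C, hC⟩ := isCompact_Icc.exists_bound_of_continuousOn (s := Set.Icc a b) hf.continuousOn
  exact Integrable.of_bound hf.aestronglyMeasurable C (hμ'.mono hC)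

/-- The Chebyshev polynomials span all polynomials, having one member in each degree, and the
integral is linear. -/
lemma integral_polynomial_eq_of_integral_shiftedChebyshev_eq {a b : ℝ} {μ ν : Measure ℝ}
    (hμ : μ ∈ mixedStrategies a b) (hν : ν ∈ mixedStrategies a b)
    (h : ∀ n, ∫ x, shiftedChebyshev a b n x ∂μ = ∫ x, shiftedChebyshev a b n x ∂ν) (p : ℝ[X]) :
    ∫ x, p.eval ((x - (a + b) / 2) / ((b - a) / 2)) ∂μ =
      ∫ x, p.eval ((x - (a + b) / 2) / ((b - a) / 2)) ∂ν := by
  have hp : p ∈ Submodule.span ℝ (Set.range (Chebyshev.chebyshevTsequence ℝ)) := by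
    rw [Sequence.span _ (by simp)]
    exact Submodule.mem_top
  have hi : ∀ (ρ : Measure ℝ), ρ ∈ mixedStrategies a b → ∀ q : ℝ[X],
      Integrable (fun x => q.eval ((x - (a + b) / 2) / ((b - a) / 2))) ρ := fun ρ hρ q =>
    integrable_of_continuous_of_mem_mixedStrategies hρ (by fun_prop)
  induction hp using Submodule.span_induction with
  | mem q hq =>
    obtain ⟨n, rfl⟩ := hq
    exact h n
  | zero => simp
  | add q r _ _ hq hr =>
    simp only [eval_add]
    rw [integral_add (hi μ hμ q) (hi μ hμ r), integral_add (hi ν hν q) (hi ν hν r), hq, hr]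
  | smul c q _ hq =>
    simp only [eval_smul, smul_eq_mul]
    rw [MeasureTheory.integral_const_mul, MeasureTheory.integral_const_mul, hq]

/-- A probability measure on `[a, b]` is determined by its Chebyshev moments. -/
lemma eq_of_integral_shiftedChebyshev_eq {a b : ℝ} (hab : a < b) {μ ν : Measure ℝ}
    (hμ : μ ∈ mixedStrategies a b) (hν : ν ∈ mixedStrategies a b)
    (h : ∀ n, ∫ x, shiftedChebyshev a b n x ∂μ = ∫ x, shiftedChebyshev a b n x ∂ν) : μ = ν := by
  have := hμ.1
  have := hν.1
  refine ext_of_forall_integral_eq_of_IsFiniteMeasure fun f => ?_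
  refine eq_of_forall_dist_le fun ε hε => ?_
  obtain ⟨p, hp⟩ := exists_polynomial_near_of_continuousOn a b f f.continuous.continuousOn
    (ε / 2) (by positivity)
  have hba : b - a ≠ 0 := (sub_pos.mpr hab).ne'
  have heq : ∫ x, p.eval x ∂μ = ∫ x, p.eval x ∂ν := by
    -- Composition with the affine map undoes the normalisation of `[a, b]` to `[-1, 1]`.
    have := integral_polynomial_eq_of_integral_shiftedChebyshev_eq hμ hν h
      (p.comp (C ((b - a) / 2) * X + C ((a + b) / 2)))
    have hx : ∀ x : ℝ, (b - a) / 2 * ((x - (a + b) / 2) / ((b - a) / 2)) + (a + b) / 2 = x := by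
      intro x
      field_simp
      ring
    simpa only [eval_comp, eval_add, eval_mul, eval_C, eval_X, hx] using this
  have hdist : ∀ ρ : Measure ℝ, ρ ∈ mixedStrategies a b →
      dist (∫ x, f x ∂ρ) (∫ x, p.eval x ∂ρ) ≤ ε / 2 := by
    intro ρ hρ
    have := hρ.1
    have hρ' : ∀ᵐ x ∂ρ, x ∈ Set.Icc a b := hρ.2
    rw [dist_eq_norm, ← integral_sub
      (integrable_of_continuous_of_mem_mixedStrategies hρ f.continuous)
      (integrable_of_continuous_of_mem_mixedStrategies hρ p.continuous)]
    refine (MeasureTheory.norm_integral_le_of_norm_le_const (C := ε / 2) ?_).trans (by simp)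
    filter_upwards [hρ'] with x hx
    rw [Real.norm_eq_abs, abs_sub_comm]
    exact (hp x hx).le
  calc dist (∫ x, f x ∂μ) (∫ x, f x ∂ν)
      ≤ dist (∫ x, f x ∂μ) (∫ x, p.eval x ∂μ) + dist (∫ x, p.eval x ∂μ) (∫ x, f x ∂ν) :=
        dist_triangle _ _ _
    _ ≤ ε / 2 + ε / 2 := by
        refine add_le_add (hdist μ hμ) ?_
        rw [heq, dist_comm]
        exact hdist ν hν
    _ = ε := by ring

/-- A probability measure on `[a, b]` whose logarithmic potential is almost everywhere constant
on `[a, b]` is the arcsine distribution. -/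
lemma eq_arcsineMeasure_of_potential_ae_const {a b c : ℝ} (hab : a < b) {μ : Measure ℝ}
    (hμ : μ ∈ mixedStrategies a b)
    (h : ∀ᵐ y ∂(arcsineMeasure a b), ∫ x, Real.log |x - y| ∂μ = c) : μ = arcsineMeasure a b := by
  have := hμ.1
  have hμ' : ∀ᵐ x ∂μ, x ∈ Set.Icc a b := hμ.2
  have harc := arcsineMeasure_mem_mixedStrategies hab
  have := harc.1
  have harc' : ∀ᵐ y ∂(arcsineMeasure a b), y ∈ Set.Icc a b := harc.2
  refine eq_of_integral_shiftedChebyshev_eq hab hμ harc fun n => ?_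
  cases n with
  | zero => simp [shiftedChebyshev]
  | succ n =>
    have hint : Integrable (fun p : ℝ × ℝ => Real.log |p.1 - p.2| * shiftedChebyshev a b (n + 1) p.2)
        (μ.prod (arcsineMeasure a b)) := by
      refine (integrable_log_abs_sub_prod hab μ hμ.2).mul_bdd (c := 1)
        ((continuous_shiftedChebyshev a b _).comp continuous_snd).aestronglyMeasurable ?_
      filter_upwards [Measure.quasiMeasurePreserving_snd.ae harc'] with p hp
      exact abs_shiftedChebyshev_le hab _ hp
    -- The double integral is evaluated in both orders: integrating in `y` first gives the
    -- eigenvalue times the moment of `μ`; integrating in `x` first gives `c` times the vanishing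
    -- moment of the arcsine law.
    have hswap := integral_integral_swap
      (f := fun x y => Real.log |x - y| * shiftedChebyshev a b (n + 1) y) hint
    have hl : ∫ x, ∫ y, Real.log |x - y| * shiftedChebyshev a b (n + 1) y ∂(arcsineMeasure a b) ∂μ =
        -(1 / (n + 1 : ℕ)) * ∫ x, shiftedChebyshev a b (n + 1) x ∂μ := by
      rw [← MeasureTheory.integral_const_mul]
      refine integral_congr_ae ?_
      filter_upwards [hμ'] with x hx
      exact integral_log_abs_sub_mul_shiftedChebyshev hab hx n
    have hr : ∫ y, ∫ x, Real.log |x - y| * shiftedChebyshev a b (n + 1) y ∂μ ∂(arcsineMeasure a b) =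
        0 := by
      rw [← mul_zero c, ← integral_shiftedChebyshev_arcsineMeasure hab n,
        ← MeasureTheory.integral_const_mul]
      refine integral_congr_ae ?_
      filter_upwards [h] with y hy
      rw [MeasureTheory.integral_mul_const, hy]
    rw [hl, hr] at hswap
    rw [integral_shiftedChebyshev_arcsineMeasure hab]
    refine (mul_eq_zero.mp hswap).resolve_left ?_
    exact neg_ne_zero.mpr (by positivity)

/-! ### Inversion and the flipped arcsine law. -/

lemma inv_mem_Ioo_inv_iff {a b x : ℝ} (ha : 0 < a) (hab : a < b) :
    x⁻¹ ∈ Set.Ioo b⁻¹ a⁻¹ ↔ x ∈ Set.Ioo a b := by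
  constructor
  · intro h
    have hx : 0 < x := inv_pos.mp ((inv_pos.mpr (ha.trans hab)).trans h.1)
    exact ⟨(inv_lt_inv₀ hx ha).mp h.2, (inv_lt_inv₀ (ha.trans hab) hx).mp h.1⟩
  · intro h
    exact ⟨inv_strictAnti₀ (ha.trans h.1) h.2, inv_strictAnti₀ ha h.1⟩

lemma inv_mem_Icc_inv_iff {a b x : ℝ} (ha : 0 < a) (hab : a < b) :
    x⁻¹ ∈ Set.Icc b⁻¹ a⁻¹ ↔ x ∈ Set.Icc a b := by
  constructor
  · intro h
    have hx : 0 < x := inv_pos.mp ((inv_pos.mpr (ha.trans hab)).trans_le h.1)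
    exact ⟨(inv_le_inv₀ hx ha).mp h.2, (inv_le_inv₀ (ha.trans hab) hx).mp h.1⟩
  · intro h
    exact ⟨inv_anti₀ (ha.trans_le h.1) h.2, inv_anti₀ ha h.1⟩

/-- Change of variables under inversion. The relative density is positive and bounded on `(m, M)`,
which transfers null sets and integrability between the two laws. -/
lemma flippedArcsineMeasure_eq_withDensity {m M : ℝ} (hm : 0 < m) (hmM : m < M) :
    flippedArcsineMeasure m M =
      (arcsineMeasure m M).withDensity fun x => ENNReal.ofReal (√(m * M) / x) := by
  have hM : 0 < M := hm.trans hmM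
  ext s hs
  have hs' : MeasurableSet ((fun x : ℝ => x⁻¹) ⁻¹' s) := measurable_inv hs
  have himage : (fun x : ℝ => x⁻¹) '' Set.Ioo m M = Set.Ioo M⁻¹ m⁻¹ := by
    ext y
    simp only [Set.image_inv_eq_inv, Set.mem_inv]
    conv_lhs => rw [← inv_inv m, ← inv_inv M]
    exact inv_mem_Ioo_inv_iff (inv_pos.mpr hM) (inv_strictAnti₀ hm hmM)
  have hd : ∀ x ∈ Set.Ioo m M, HasDerivWithinAt (fun x : ℝ => x⁻¹) (-(x ^ 2)⁻¹)
      (Set.Ioo m M) x := fun x hx => (hasDerivAt_inv (hm.trans hx.1).ne').hasDerivWithinAt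
  have h1 : flippedArcsineMeasure m M s = ∫⁻ x in Set.Ioo M⁻¹ m⁻¹,
      ENNReal.ofReal (1 / (Real.pi * √((m⁻¹ - x) * (x - M⁻¹)))) * s.indicator 1 x⁻¹ := by
    rw [flippedArcsineMeasure, Measure.map_apply measurable_inv hs, arcsineMeasure,
      withDensity_apply _ hs', ← lintegral_indicator hs', ← lintegral_indicator measurableSet_Ioo]
    refine lintegral_congr fun x => ?_
    by_cases hx : x⁻¹ ∈ s <;> by_cases hx' : x ∈ Set.Ioo M⁻¹ m⁻¹ <;> simp [hx, hx']
  have hmeas : Measurable fun x : ℝ => ENNReal.ofReal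
      ((Set.Ioo m M).indicator (fun y => 1 / (Real.pi * √((M - y) * (y - m)))) x) :=
    ((by fun_prop : Measurable fun y : ℝ => 1 / (Real.pi * √((M - y) * (y - m)))).indicator
      measurableSet_Ioo).ennreal_ofReal
  rw [h1, ← himage, lintegral_image_eq_lintegral_abs_deriv_mul measurableSet_Ioo hd
    inv_injective.injOn, arcsineMeasure, ← withDensity_mul _ hmeas (by fun_prop),
    withDensity_apply _ hs, ← lintegral_indicator hs, ← lintegral_indicator measurableSet_Ioo]
  refine lintegral_congr fun x => ?_
  by_cases hx : x ∈ s
  · by_cases hx' : x ∈ Set.Ioo m M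
    · have hx0 : 0 < x := hm.trans hx'.1
      have h2 : (m⁻¹ - x⁻¹) * (x⁻¹ - M⁻¹) = (M - x) * (x - m) / (√(m * M) * x) ^ 2 := by
        rw [mul_pow, Real.sq_sqrt (by positivity)]
        field_simp
      have h3 : 0 < √(m * M) := Real.sqrt_pos.mpr (by positivity)
      have h4 : 0 < (M - x) * (x - m) := mul_pos (sub_pos.mpr hx'.2) (sub_pos.mpr hx'.1)
      have h5 := Real.sqrt_pos.mpr h4
      simp only [hx, hx', Set.indicator_of_mem, inv_inv, Pi.one_apply, mul_one, Pi.mul_apply]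
      rw [h2, Real.sqrt_div h4.le, Real.sqrt_sq (by positivity), ← ENNReal.ofReal_mul (abs_nonneg _),
        ← ENNReal.ofReal_mul (by positivity), abs_neg, abs_of_pos (by positivity)]
      congr 1
      have := Real.pi_pos
      field_simp
    · rw [Set.indicator_of_notMem hx', Set.indicator_of_mem hx, Pi.mul_apply,
        Set.indicator_of_notMem hx', ENNReal.ofReal_zero, zero_mul]
  · simp [hx]

lemma arcsineMeasure_absolutelyContinuous_flippedArcsineMeasure {m M : ℝ} (hm : 0 < m)
    (hmM : m < M) : arcsineMeasure m M ≪ flippedArcsineMeasure m M := by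
  rw [flippedArcsineMeasure_eq_withDensity hm hmM]
  refine withDensity_absolutelyContinuous' (by fun_prop) ?_
  have hs : ∀ᵐ y ∂(arcsineMeasure m M), y ∈ Set.Ioo m M := arcsineMeasure_compl_Ioo m M
  filter_upwards [hs] with y hy
  have hy0 : 0 < y := hm.trans hy.1
  have : 0 < √(m * M) := Real.sqrt_pos.mpr (mul_pos hm (hm.trans hmM))
  simp only [ne_eq, ENNReal.ofReal_eq_zero, not_le]
  positivity

lemma flippedArcsineMeasure_le_smul_arcsineMeasure {m M : ℝ} (hm : 0 < m) (hmM : m < M) :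
    flippedArcsineMeasure m M ≤ ENNReal.ofReal (√(m * M) / m) • arcsineMeasure m M := by
  rw [flippedArcsineMeasure_eq_withDensity hm hmM, ← withDensity_const]
  refine withDensity_mono ?_
  have hs : ∀ᵐ y ∂(arcsineMeasure m M), y ∈ Set.Ioo m M := arcsineMeasure_compl_Ioo m M
  filter_upwards [hs] with y hy
  exact ENNReal.ofReal_le_ofReal (div_le_div_of_nonneg_left (Real.sqrt_nonneg _) hm hy.1.le)

lemma integrable_log_abs_sub_prod_flippedArcsineMeasure {m M : ℝ} (hm : 0 < m) (hmM : m < M)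
    {μ : Measure ℝ} (hμ : μ ∈ mixedStrategies m M) :
    Integrable (fun p : ℝ × ℝ => Real.log |p.1 - p.2|) (μ.prod (flippedArcsineMeasure m M)) := by
  have := hμ.1
  have := isProbabilityMeasure_arcsineMeasure hmM
  refine Integrable.mono_measure ?_ (Measure.prod_mono le_rfl
    (flippedArcsineMeasure_le_smul_arcsineMeasure hm hmM))
  rw [Measure.prod_smul_right]
  exact (integrable_log_abs_sub_prod hmM μ hμ.2).smul_measure ENNReal.ofReal_ne_top

lemma map_inv_mem_mixedStrategies {m M : ℝ} (hm : 0 < m) (hmM : m < M) {μ : Measure ℝ}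
    (hμ : μ ∈ mixedStrategies m M) : μ.map (fun x => x⁻¹) ∈ mixedStrategies M⁻¹ m⁻¹ := by
  have := hμ.1
  refine ⟨Measure.isProbabilityMeasure_map measurable_inv.aemeasurable, ?_⟩
  rw [Measure.map_apply measurable_inv measurableSet_Icc.compl]
  have : (fun x : ℝ => x⁻¹) ⁻¹' (Set.Icc M⁻¹ m⁻¹)ᶜ = (Set.Icc m M)ᶜ := by
    ext x
    exact (inv_mem_Icc_inv_iff hm hmM).not
  rw [this, hμ.2]

lemma map_inv_map_inv (μ : Measure ℝ) : (μ.map fun x => x⁻¹).map (fun x => x⁻¹) = μ := by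
  rw [Measure.map_map measurable_inv measurable_inv]
  simp

lemma map_inv_flippedArcsineMeasure (m M : ℝ) :
    (flippedArcsineMeasure m M).map (fun x => x⁻¹) = arcsineMeasure M⁻¹ m⁻¹ :=
  map_inv_map_inv _

lemma flippedArcsineMeasure_mem_mixedStrategies {m M : ℝ} (hm : 0 < m) (hmM : m < M) :
    flippedArcsineMeasure m M ∈ mixedStrategies m M := by
  have hM : 0 < M := hm.trans hmM
  have h := inv_strictAnti₀ hm hmM
  have := map_inv_mem_mixedStrategies (inv_pos.mpr hM) h (arcsineMeasure_mem_mixedStrategies h)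
  rwa [inv_inv, inv_inv] at this

/-! ### The extended payoff in terms of real integrals. -/

lemma extLogAbs_of_ne_zero {x : ℝ} (hx : x ≠ 0) : extLogAbs x = ((Real.log |x| : ℝ) : EReal) := by
  rw [extLogAbs, ENNReal.log_ofReal_of_pos (abs_pos.mpr hx)]

lemma extExpectation_eq_integral {α : Type*} [MeasurableSpace α] {P : Measure α} {f : α → EReal}
    {g : α → ℝ} (hfg : ∀ᵐ x ∂P, f x = (g x : EReal)) (hg : Integrable g P) :
    extExpectation P f = ((∫ x, g x ∂P : ℝ) : EReal) := by
  have h1 : ∫⁻ x, (f x).toENNReal ∂P = ∫⁻ x, ENNReal.ofReal (g x) ∂P := by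
    refine lintegral_congr_ae ?_
    filter_upwards [hfg] with x hx
    rw [hx, EReal.real_coe_toENNReal]
  have h2 : ∫⁻ x, (-f x).toENNReal ∂P = ∫⁻ x, ENNReal.ofReal (-g x) ∂P := by
    refine lintegral_congr_ae ?_
    filter_upwards [hfg] with x hx
    rw [hx, ← EReal.coe_neg, EReal.real_coe_toENNReal]
  have hpos : ∫⁻ x, ENNReal.ofReal (g x) ∂P ≠ ⊤ := hg.lintegral_lt_top.ne
  have hneg : ∫⁻ x, ENNReal.ofReal (-g x) ∂P ≠ ⊤ := hg.neg.lintegral_lt_top.ne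
  rw [extExpectation, h1, h2, integral_eq_lintegral_pos_part_sub_lintegral_neg_part hg,
    EReal.coe_sub, EReal.coe_ennreal_toReal hpos, EReal.coe_ennreal_toReal hneg]

/-- Inversion exchanges the two players. -/
lemma payoff_map_inv (μ ν : Measure ℝ) [SFinite μ] [SFinite ν] :
    payoff (ν.map fun x => x⁻¹) (μ.map fun x => x⁻¹) = payoff μ ν := by
  have h : (ν.map fun x => x⁻¹).prod (μ.map fun x => x⁻¹) = (μ.prod ν).map
      (MeasurableEquiv.prodComm.trans
        ((MeasurableEquiv.inv ℝ).prodCongr (MeasurableEquiv.inv ℝ))) := by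
    rw [Measure.map_prod_map _ _ measurable_inv measurable_inv, ← Measure.prod_swap,
      Measure.map_map (by fun_prop) measurable_swap]
    rfl
  rw [payoff, payoff, extExpectation, extExpectation, h, lintegral_map_equiv, lintegral_map_equiv]
  have : ∀ p : ℝ × ℝ, ((MeasurableEquiv.prodComm.trans
      ((MeasurableEquiv.inv ℝ).prodCongr (MeasurableEquiv.inv ℝ))) p) = (p.2⁻¹, p.1⁻¹) :=
    fun p => rfl
  -- The quantity `β⁻¹ l` is unchanged when `(β, l)` is replaced by `(l⁻¹, β⁻¹)`.
  simp only [this, inv_inv, mul_comm]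

/-- The splitting `log |1 - β⁻¹ l| = log |β - l| - log β`. The diagonal must be null: there the
payoff kernel is `-∞`, while `Real.log 0 = 0`. -/
lemma payoff_eq_coe {m M : ℝ} (hm : 0 < m) {μ ν : Measure ℝ} (hμ : μ ∈ mixedStrategies m M)
    [IsProbabilityMeasure ν] (hne : ∀ᵐ p ∂(μ.prod ν), p.1 ≠ p.2)
    (hi : Integrable (fun p : ℝ × ℝ => Real.log |p.1 - p.2|) (μ.prod ν)) :
    payoff μ ν =
      ((∫ p, Real.log |p.1 - p.2| ∂(μ.prod ν) - ∫ x, Real.log x ∂μ : ℝ) : EReal) := by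
  have := hμ.1
  have hμ' : ∀ᵐ x ∂μ, x ∈ Set.Icc m M := hμ.2
  have hlog : Integrable Real.log μ := by
    refine Integrable.of_bound Real.measurable_log.aestronglyMeasurable
      (max |Real.log m| |Real.log M|) ?_
    filter_upwards [hμ'] with x hx
    rw [Real.norm_eq_abs, abs_le]
    have h1 := Real.log_le_log hm hx.1
    have h2 := Real.log_le_log (hm.trans_le hx.1) hx.2
    have h3 := neg_abs_le (Real.log m)
    have h4 := le_abs_self (Real.log M)
    have h5 := le_max_left |Real.log m| |Real.log M|
    have h6 := le_max_right |Real.log m| |Real.log M|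
    constructor <;> linarith
  have hlog' : Integrable (fun p : ℝ × ℝ => Real.log p.1) (μ.prod ν) := hlog.comp_fst ν
  have hfst : ∫ p, Real.log p.1 ∂(μ.prod ν) = ∫ x, Real.log x ∂μ := by
    rw [integral_fun_fst]
    simp
  rw [payoff, extExpectation_eq_integral (g := fun p => Real.log |p.1 - p.2| - Real.log p.1) ?_
    (hi.sub hlog'), integral_sub hi hlog', hfst]
  filter_upwards [hne, Measure.quasiMeasurePreserving_fst.ae hμ'] with p hp hp'
  have hp0 : p.1 ≠ 0 := (hm.trans_le hp'.1).ne'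
  have h1 : 1 - p.1⁻¹ * p.2 = (p.1 - p.2) / p.1 := by
    field_simp
  have h2 : p.1 - p.2 ≠ 0 := sub_ne_zero.mpr hp
  rw [h1, extLogAbs_of_ne_zero (div_ne_zero h2 hp0), Real.log_abs,
    Real.log_div h2 hp0, Real.log_abs]

lemma ae_prod_fst_ne_snd (μ ν : Measure ℝ) [SFinite μ] [SFinite ν] [NullSingletonClass ν] :
    ∀ᵐ p ∂(μ.prod ν), p.1 ≠ p.2 := by
  have hs : MeasurableSet {p : ℝ × ℝ | p.1 ≠ p.2}ᶜ := by
    exact (measurableSet_eq_fun measurable_fst measurable_snd).compl.compl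
  refine (Measure.measure_prod_null hs).mpr (Filter.Eventually.of_forall fun x => ?_)
  have : Prod.mk x ⁻¹' {p : ℝ × ℝ | p.1 ≠ p.2}ᶜ = {x} := by
    ext y
    simp [eq_comm]
  simp only [this, measure_singleton, Pi.zero_apply]

/-- The right side is the arcsine potential minus the arcsine mean of `log`; the identity rests on
`M - m = (√M - √m) (√M + √m)`. -/
lemma log_accRate {m M : ℝ} (hm : 0 < m) (hmM : m < M) :
    Real.log (accRate m M) = Real.log ((M - m) / 4) - 2 * Real.log ((√M + √m) / 2) := by
  have h1 : 0 < √m := Real.sqrt_pos.mpr hm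
  have h2 : √m < √M := Real.sqrt_lt_sqrt hm.le hmM
  have hM : 0 < √M := h1.trans h2
  have h3 : accRate m M = ((M - m) / 4) / ((√M + √m) / 2) ^ 2 := by
    have h4 : M - m = (√M - √m) * (√M + √m) := by
      nlinarith [Real.sq_sqrt hm.le, Real.sq_sqrt (hm.trans hmM).le]
    rw [accRate, Real.sqrt_div (hm.trans hmM).le, h4]
    field_simp
    ring
  rw [h3, Real.log_div (by linarith) (by positivity), Real.log_pow]
  norm_num

lemma accRate_inv {m M : ℝ} : accRate M⁻¹ m⁻¹ = accRate m M := by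
  rw [accRate, accRate, show m⁻¹ / M⁻¹ = M / m by rw [div_inv_eq_mul, mul_comm, div_eq_mul_inv]]

/-! ### The two equalizing strategies. -/

/-- Against the arcsine distribution every strategy has the same payoff. -/
lemma payoff_arcsineMeasure {m M : ℝ} (hm : 0 < m) (hmM : m < M) {ν : Measure ℝ}
    (hν : ν ∈ mixedStrategies m M) :
    payoff (arcsineMeasure m M) ν = ((Real.log (accRate m M) : ℝ) : EReal) := by
  have := hν.1
  have hν' : ∀ᵐ x ∂ν, x ∈ Set.Icc m M := hν.2
  have harc := arcsineMeasure_mem_mixedStrategies hmM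
  have := harc.1
  have hne : ∀ᵐ p ∂((arcsineMeasure m M).prod ν), p.1 ≠ p.2 :=
    (Measure.measurePreserving_swap.quasiMeasurePreserving.ae
      (ae_prod_fst_ne_snd ν (arcsineMeasure m M))).mono fun p hp => hp.symm
  have hi := integrable_log_abs_sub_prod hmM ν hν.2
  have hi' : Integrable (fun p : ℝ × ℝ => Real.log |p.1 - p.2|) ((arcsineMeasure m M).prod ν) := by
    refine hi.swap.congr (Filter.Eventually.of_forall fun p => ?_)
    simp only [Function.comp_apply, Prod.fst_swap, Prod.snd_swap, abs_sub_comm]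
  have hval : ∫ p, Real.log |p.1 - p.2| ∂((arcsineMeasure m M).prod ν) = Real.log ((M - m) / 4) := by
    rw [← integral_prod_swap]
    refine (integral_prod _ hi'.swap).trans ?_
    have : ∀ᵐ x ∂ν, ∫ y, ((fun p : ℝ × ℝ => Real.log |p.1 - p.2|) ∘ Prod.swap) (x, y)
        ∂(arcsineMeasure m M) = Real.log ((M - m) / 4) := by
      filter_upwards [hν'] with x hx
      simp only [Function.comp_apply, Prod.swap_prod_mk, abs_sub_comm _ x]
      exact integral_log_abs_sub_arcsineMeasure hmM hx
    refine (integral_congr_ae this).trans ?_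
    simp
  rw [payoff_eq_coe hm harc hne hi', hval, integral_log_arcsineMeasure hm hmM, log_accRate hm hmM]

/-- Against the flipped arcsine distribution every strategy has the same payoff. -/
lemma payoff_flippedArcsineMeasure {m M : ℝ} (hm : 0 < m) (hmM : m < M) {μ : Measure ℝ}
    (hμ : μ ∈ mixedStrategies m M) :
    payoff μ (flippedArcsineMeasure m M) = ((Real.log (accRate m M) : ℝ) : EReal) := by
  have := hμ.1
  have := (flippedArcsineMeasure_mem_mixedStrategies hm hmM).1
  rw [← payoff_map_inv, map_inv_flippedArcsineMeasure, payoff_arcsineMeasure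
    (inv_pos.mpr (hm.trans hmM)) (inv_strictAnti₀ hm hmM) (map_inv_mem_mixedStrategies hm hmM hμ),
    accRate_inv]

/-! ### Uniqueness of the optimal strategies. -/

lemma dirac_mem_mixedStrategies {m M x : ℝ} (hx : x ∈ Set.Icc m M) :
    Measure.dirac x ∈ mixedStrategies m M :=
  ⟨inferInstance, by rw [Measure.dirac_apply' _ measurableSet_Icc.compl]; simp [hx]⟩

instance nullSingletonClass_flippedArcsineMeasure (m M : ℝ) :
    NullSingletonClass (flippedArcsineMeasure m M) := by
  refine ⟨fun x => ?_⟩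
  rw [flippedArcsineMeasure, Measure.map_apply measurable_inv (measurableSet_singleton x),
    show (fun x : ℝ => x⁻¹) ⁻¹' {x} = {x⁻¹} by ext y; simp, measure_singleton]

lemma payoff_dirac {m M y : ℝ} (hm : 0 < m) {μ : Measure ℝ} (hμ : μ ∈ mixedStrategies m M)
    (hne : ∀ᵐ x ∂μ, x ≠ y) (hi : Integrable (fun x => Real.log |x - y|) μ) :
    payoff μ (Measure.dirac y) =
      ((∫ x, Real.log |x - y| ∂μ - ∫ x, Real.log x ∂μ : ℝ) : EReal) := by
  have := hμ.1
  have hprod : μ.prod (Measure.dirac y) = μ.map fun x => (x, y) := Measure.prod_dirac y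
  have hm1 : AEMeasurable (fun x : ℝ => (x, y)) μ := by fun_prop
  have hm2 : Measurable fun p : ℝ × ℝ => Real.log |p.1 - p.2| := by fun_prop
  have hs : MeasurableSet {p : ℝ × ℝ | p.1 ≠ p.2} :=
    (measurableSet_eq_fun measurable_fst measurable_snd).compl
  rw [payoff_eq_coe hm hμ, hprod, integral_map hm1 hm2.aestronglyMeasurable]
  · rw [hprod, ae_map_iff hm1 hs]
    exact hne
  · rw [hprod, integrable_map_measure hm2.aestronglyMeasurable hm1]
    exact hi

/-- The arcsine distribution is the only strategy whose payoffs against the pure strategies lie on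
one side of the value. -/
lemma eq_arcsineMeasure_of_payoff_dirac {m M : ℝ} (hm : 0 < m) (hmM : m < M) {μ : Measure ℝ}
    (hμ : μ ∈ mixedStrategies m M)
    (h : (∀ y ∈ Set.Icc m M, payoff μ (Measure.dirac y) ≤ ((Real.log (accRate m M) : ℝ) : EReal)) ∨
      ∀ y ∈ Set.Icc m M, ((Real.log (accRate m M) : ℝ) : EReal) ≤ payoff μ (Measure.dirac y)) :
    μ = arcsineMeasure m M := by
  have := hμ.1
  have hflip := flippedArcsineMeasure_mem_mixedStrategies hm hmM
  have := hflip.1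
  have hflip' : ∀ᵐ y ∂(flippedArcsineMeasure m M), y ∈ Set.Icc m M := hflip.2
  have hi := integrable_log_abs_sub_prod_flippedArcsineMeasure hm hmM hμ
  have hne := ae_prod_fst_ne_snd μ (flippedArcsineMeasure m M)
  have hne' : ∀ᵐ y ∂(flippedArcsineMeasure m M), ∀ᵐ x ∂μ, x ≠ y :=
    Measure.ae_ae_of_ae_prod (Measure.measurePreserving_swap.quasiMeasurePreserving.ae hne)
  set V := Real.log (accRate m M)
  set c := ∫ x, Real.log x ∂μ
  set u : ℝ → ℝ := fun y => ∫ x, Real.log |x - y| ∂μ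
  have hpay : ∀ᵐ y ∂(flippedArcsineMeasure m M),
      y ∈ Set.Icc m M ∧ payoff μ (Measure.dirac y) = ((u y - c : ℝ) : EReal) := by
    filter_upwards [hflip', hne', hi.prod_left_ae] with y hy h1 h2
    exact ⟨hy, payoff_dirac hm hμ h1 h2⟩
  have hui : Integrable u (flippedArcsineMeasure m M) := hi.integral_prod_right
  have hdi : Integrable (fun y => u y - c - V) (flippedArcsineMeasure m M) :=
    (hui.sub (integrable_const c)).sub (integrable_const V)
  -- The equalizing property of the flipped law: the payoffs of `μ` against pure strategies average
  -- to exactly `V`.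
  have hval : ∫ y, u y ∂(flippedArcsineMeasure m M) - c = V := by
    have h1 := payoff_flippedArcsineMeasure hm hmM hμ
    rw [payoff_eq_coe hm hμ hne hi, integral_prod_symm _ hi] at h1
    exact_mod_cast h1
  have hzero : ∫ y, (u y - c - V) ∂(flippedArcsineMeasure m M) = 0 := by
    have huc : Integrable (fun y => u y - c) (flippedArcsineMeasure m M) :=
      hui.sub (integrable_const c)
    rw [integral_sub huc (integrable_const V), integral_sub hui (integrable_const c)]
    simp only [MeasureTheory.integral_const, probReal_univ, one_smul]
    linarith
  -- A function of constant sign with zero integral vanishes almost everywhere.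
  have hae : ∀ᵐ y ∂(flippedArcsineMeasure m M), u y - c - V = 0 := by
    rcases h with h | h
    · have h1 : 0 ≤ᵐ[flippedArcsineMeasure m M] fun y => -(u y - c - V) := by
        filter_upwards [hpay] with y ⟨hy, hp⟩
        have h2 := h y hy
        rw [hp, EReal.coe_le_coe_iff] at h2
        simp only [Pi.zero_apply]
        linarith
      have h2 := (integral_eq_zero_iff_of_nonneg_ae h1 hdi.neg).mp
        (by rw [MeasureTheory.integral_neg, hzero, neg_zero])
      filter_upwards [h2] with y hy
      exact neg_eq_zero.mp hy
    · have h1 : 0 ≤ᵐ[flippedArcsineMeasure m M] fun y => u y - c - V := by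
        filter_upwards [hpay] with y ⟨hy, hp⟩
        have h2 := h y hy
        rw [hp, EReal.coe_le_coe_iff] at h2
        simp only [Pi.zero_apply]
        linarith
      exact (integral_eq_zero_iff_of_nonneg_ae h1 hdi).mp hzero
  refine eq_arcsineMeasure_of_potential_ae_const (c := V + c) hmM hμ ?_
  filter_upwards [(arcsineMeasure_absolutelyContinuous_flippedArcsineMeasure hm hmM).ae_le hae]
    with y hy
  change u y = V + c
  linarith

lemma eq_arcsineMeasure_of_payoff_le {m M : ℝ} (hm : 0 < m) (hmM : m < M) {μ : Measure ℝ}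
    (hμ : μ ∈ mixedStrategies m M)
    (h : ∀ ν ∈ mixedStrategies m M, payoff μ ν ≤ ((Real.log (accRate m M) : ℝ) : EReal)) :
    μ = arcsineMeasure m M :=
  eq_arcsineMeasure_of_payoff_dirac hm hmM hμ
    (Or.inl fun _ hy => h _ (dirac_mem_mixedStrategies hy))

/-- Inversion turns `ν` into a strategy of the first player on `[M⁻¹, m⁻¹]` whose payoffs against
pure strategies are all at least the value; this is the second alternative of
`eq_arcsineMeasure_of_payoff_dirac`. -/
lemma eq_flippedArcsineMeasure_of_le_payoff {m M : ℝ} (hm : 0 < m) (hmM : m < M) {ν : Measure ℝ}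
    (hν : ν ∈ mixedStrategies m M)
    (h : ∀ μ ∈ mixedStrategies m M, ((Real.log (accRate m M) : ℝ) : EReal) ≤ payoff μ ν) :
    ν = flippedArcsineMeasure m M := by
  have hM := hm.trans hmM
  have := hν.1
  have key : ν.map (fun x => x⁻¹) = arcsineMeasure M⁻¹ m⁻¹ := by
    refine eq_arcsineMeasure_of_payoff_dirac (inv_pos.mpr hM) (inv_strictAnti₀ hm hmM)
      (map_inv_mem_mixedStrategies hm hmM hν) (Or.inr fun y hy => ?_)
    have hy' : y⁻¹ ∈ Set.Icc m M := by
      have hy0 : 0 < y := (inv_pos.mpr hM).trans_le hy.1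
      exact ⟨(le_inv_comm₀ hm hy0).mpr hy.2, (inv_le_comm₀ hy0 hM).mpr hy.1⟩
    have h1 : (Measure.dirac y⁻¹).map (fun x : ℝ => x⁻¹) = Measure.dirac y := by
      rw [MeasureTheory.Measure.map_dirac' measurable_inv, inv_inv]
    rw [← h1, payoff_map_inv, accRate_inv]
    exact h _ (dirac_mem_mixedStrategies hy')
  rw [← map_inv_map_inv ν, key, flippedArcsineMeasure]

end

theorem mainTheorem7 (m M : ℝ) (hm : 0 < m) (hmM : m < M) :
    -- the two candidate distributions are admissible mixed strategies
    arcsineMeasure m M ∈ mixedStrategies m M ∧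
    flippedArcsineMeasure m M ∈ mixedStrategies m M ∧
    -- the saddle point condition
    (⨆ ν ∈ mixedStrategies m M, payoff (arcsineMeasure m M) ν) =
      payoff (arcsineMeasure m M) (flippedArcsineMeasure m M) ∧
    payoff (arcsineMeasure m M) (flippedArcsineMeasure m M) =
      (⨅ μ ∈ mixedStrategies m M, payoff μ (flippedArcsineMeasure m M)) ∧
    payoff (arcsineMeasure m M) (flippedArcsineMeasure m M) =
      ((Real.log (accRate m M) : ℝ) : EReal) ∧
    -- the minimax value of the game
    (⨅ μ ∈ mixedStrategies m M, ⨆ ν ∈ mixedStrategies m M, payoff μ ν) =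
      ((Real.log (accRate m M) : ℝ) : EReal) ∧
    (⨆ ν ∈ mixedStrategies m M, ⨅ μ ∈ mixedStrategies m M, payoff μ ν) =
      ((Real.log (accRate m M) : ℝ) : EReal) ∧
    -- the optimal mixed strategy of each player is unique
    (∀ μ ∈ mixedStrategies m M,
      IsMinOn (fun μ' => ⨆ ν ∈ mixedStrategies m M, payoff μ' ν) (mixedStrategies m M) μ ↔
        μ = arcsineMeasure m M) ∧
    (∀ ν ∈ mixedStrategies m M,
      IsMaxOn (fun ν' => ⨅ μ ∈ mixedStrategies m M, payoff μ ν') (mixedStrategies m M) ν ↔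
        ν = flippedArcsineMeasure m M) ∧
    -- the saddle point is unique
    (∀ μ ∈ mixedStrategies m M, ∀ ν ∈ mixedStrategies m M,
      IsSaddlePointOn (mixedStrategies m M) (mixedStrategies m M) payoff μ ν ↔
        μ = arcsineMeasure m M ∧ ν = flippedArcsineMeasure m M) := by

  have hA := arcsineMeasure_mem_mixedStrategies hmM
  have hF := flippedArcsineMeasure_mem_mixedStrategies hm hmM
  have hpA := fun ν hν => payoff_arcsineMeasure (ν := ν) hm hmM hν
  have hpF := fun μ hμ => payoff_flippedArcsineMeasure (μ := μ) hm hmM hμ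
  have hsup : (⨆ ν ∈ mixedStrategies m M, payoff (arcsineMeasure m M) ν) =
      ((Real.log (accRate m M) : ℝ) : EReal) :=
    le_antisymm (iSup₂_le fun ν hν => (hpA ν hν).le) ((hpA _ hF).ge.trans
      (le_iSup₂ (f := fun ν _ => payoff (arcsineMeasure m M) ν) _ hF))
  have hinf : (⨅ μ ∈ mixedStrategies m M, payoff μ (flippedArcsineMeasure m M)) =
      ((Real.log (accRate m M) : ℝ) : EReal) :=
    le_antisymm ((iInf₂_le _ hA).trans (hpF _ hA).le) (le_iInf₂ fun μ hμ => (hpF μ hμ).ge)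
  -- Replying with the other player's equalizing strategy bounds the guarantee of an arbitrary
  -- strategy by the value, here and in `hupper`.
  have hlower : ∀ μ ∈ mixedStrategies m M, ((Real.log (accRate m M) : ℝ) : EReal) ≤
      ⨆ ν ∈ mixedStrategies m M, payoff μ ν := fun μ hμ =>
    (hpF μ hμ).ge.trans (le_iSup₂ (f := fun ν _ => payoff μ ν) _ hF)
  have hupper : ∀ ν ∈ mixedStrategies m M, (⨅ μ ∈ mixedStrategies m M, payoff μ ν) ≤
      ((Real.log (accRate m M) : ℝ) : EReal) := fun ν hν =>
    (iInf₂_le (f := fun μ _ => payoff μ ν) _ hA).trans (hpA ν hν).le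
  refine ⟨hA, hF, hsup.trans (hpA _ hF).symm, (hpA _ hF).trans hinf.symm, hpA _ hF,
    le_antisymm ((iInf₂_le _ hA).trans hsup.le) (le_iInf₂ hlower),
    le_antisymm (iSup₂_le hupper) (hinf.ge.trans
      (le_iSup₂ (f := fun ν _ => ⨅ μ ∈ mixedStrategies m M, payoff μ ν) _ hF)),
    fun μ hμ => ⟨fun h => ?_, ?_⟩, fun ν hν => ⟨fun h => ?_, ?_⟩,
    fun μ hμ ν hν => ⟨fun h => ⟨?_, ?_⟩, ?_⟩⟩
  · refine eq_arcsineMeasure_of_payoff_le hm hmM hμ fun ν hν => ?_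
    exact (le_iSup₂ (f := fun ν _ => payoff μ ν) ν hν).trans ((h hA).trans hsup.le)
  · rintro rfl μ' hμ'
    exact hsup.le.trans (hlower μ' hμ')
  · refine eq_flippedArcsineMeasure_of_le_payoff hm hmM hν fun μ hμ => ?_
    exact hinf.ge.trans ((h hF).trans (iInf₂_le (f := fun μ _ => payoff μ ν) μ hμ))
  · rintro rfl ν' hν'
    exact (hupper ν' hν').trans hinf.ge
  -- The saddle inequality is tested against `μ*`, and in the next case against `ν*`; the equalizing
  -- property turns the other side into the value.
  · exact eq_arcsineMeasure_of_payoff_le hm hmM hμ fun ν' hν' =>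
      (h _ hA ν' hν').trans (hpA ν hν).le
  · exact eq_flippedArcsineMeasure_of_le_payoff hm hmM hν fun μ' hμ' =>
      (hpF μ hμ).ge.trans (h μ' hμ' _ hF)
  · rintro ⟨rfl, rfl⟩ μ' hμ' ν' hν'
    exact (hpA ν' hν').le.trans (hpF μ' hμ').ge
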